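/- (A $100(1-\alpha)\%$ confidence interval.) Let $0<\alpha<1$, let $\Phi$ be the standard normal distribution function, and let $(P_\vartheta)_{\vartheta\in\Theta}$, $\Theta\subseteq\mathbb R$, be a family of laws on $\mathbb R$ (given for instance by probability mass functions $p_X(x\mid\vartheta)$ or densities $f_X(x\mid\vartheta)$). Fix $\theta\in\Theta$ and let $X_1,X_2,\dots$ be i.i.d. random variables with law $P_\theta$. Write $\hat\theta_n=T_n(X_1,\dots,X_n)$ for an estimate with $T_n:\mathbb R^n\to\mathbb R$ measurable; call it admissible if $E(\hat\theta_n)=\theta$ (it is unbiased) and $0<\mathrm{Var}(\hat\theta_n)<\infty$. Let $$I_n=\Big[\theta-z_{1-\frac{\alpha}{2}}\sqrt{\mathrm{Var}(\hat\theta_n)},\ \theta+z_{1-\frac{\alpha}{2}}\sqrt{\mathrm{Var}(\hat\theta_n)}\Big],\qquad z_{1-\frac{\alpha}{2}}=\Phi^{-1}\big(1-\tfrac{\alpha}{2}\big),\qquad Z_n=\frac{\hat\theta_n-\theta}{\sqrt{\mathrm{Var}(\hat\theta_n)}} .$$ 1. $z_{1-\alpha/2}$ is well defined: it is the unique real $x$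 with $\Phi(x)=1-\frac{\alpha}{2}$. For $\alpha=0.05$ it equals $1.96$ rounded to two decimals ($|z-1.96|<0.005$), and for $\alpha=0.01$ it equals $2.576$ rounded to three decimals ($|z-2.576|<0.0005$). 2. For each fixed $n$ and each admissible $\hat\theta_n$: if $|P(Z_n\le x)-\Phi(x)|\le\delta$ for all real $x$, then $|P(\hat\theta_n\in I_n)-(1-\alpha)|\le 2\delta$. 3. If $\hat\theta_n$ is admissible for all large $n$ and the normal approximation of the central limit theorem holds for it, that is, $P(Z_n\le x)\to\Phi(x)$ for every real $x$, then $\lim_{n\to\infty}P(\hat\theta_n\in I_n)=1-\alpha$. 4. If $\hat\theta_n=\frac1n\sum_{i=1}^n h(X_i)$, where $h:\mathbb R\to\mathbb R$ is measurable with $E(h(X_1))=\theta$ and $0<\mathrm{Var}(h(X_1))<\infty$ (for $h(x)=x$ this is the sample mean), then, with no further assumption, $\hat\theta_n$ is admissible for every $n\ge1$, $P(Z_n\le x)\to\Phi(x)$ for every real $x$, and $\lim_{n\to\infty}P(\hat\theta_n\in I_n)=1-\alpha$. -/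

import Mathlib

open MeasureTheory ProbabilityTheory Filter Topology

noncomputable section

/-- The standard normal distribution function `Φ`. -/
def stdNormalCDF (x : ℝ) : ℝ := cdf (gaussianReal 0 1) x

/-- The z-score `z_p = Φ⁻¹(p)`, as the `p`-quantile of the standard normal distribution. -/
def zScore (p : ℝ) : ℝ := sInf {x : ℝ | p ≤ stdNormalCDF x}

/-- `X 0, X 1, …` are independent random variables with common law `ν`; the random sample of
size `n` consists of the first `n` of them. -/
structure IsRandomSample {Ω : Type*} [MeasurableSpace Ω] (X : ℕ → Ω → ℝ) (ν : Measure ℝ)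
    (P : Measure Ω) : Prop where
  hasLaw : ∀ i, HasLaw (X i) ν P
  indep : iIndepFun X P

/-- The value of the statistic `T` on the random sample of size `n`. -/
def onSample {Ω : Type*} {n : ℕ} (T : (Fin n → ℝ) → ℝ) (X : ℕ → Ω → ℝ) (ω : Ω) : ℝ :=
  T (fun i => X i ω)

/-- `θhat` is an unbiased estimate of `θ` with positive finite variance. -/
structure IsUnbiasedEstimate {Ω : Type*} [MeasurableSpace Ω] (θhat : Ω → ℝ) (θ : ℝ)
    (P : Measure Ω) : Prop where
  memLp : MemLp θhat 2 P
  mean_eq : ∫ ω, θhat ω ∂P = θ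
  variance_pos : 0 < Var[θhat; P]

/-- The standardized estimate `(θhat - θ) / √Var(θhat)`. -/
def standardized {Ω : Type*} [MeasurableSpace Ω] (θhat : Ω → ℝ) (θ : ℝ) (P : Measure Ω)
    (ω : Ω) : ℝ :=
  (θhat ω - θ) / √(Var[θhat; P])

/-- The probability that `θhat` lies in
`[θ - z_{1-α/2} √Var(θhat), θ + z_{1-α/2} √Var(θhat)]`. -/
def coverage {Ω : Type*} [MeasurableSpace Ω] (θhat : Ω → ℝ) (θ α : ℝ) (P : Measure Ω) : ℝ :=
  P.real {ω | θhat ω ∈ Set.Icc (θ - zScore (1 - α / 2) * √(Var[θhat; P]))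
    (θ + zScore (1 - α / 2) * √(Var[θhat; P]))}

/-- The conclusion of the central limit theorem for a sequence of estimates: the distribution
functions of the standardized estimates converge pointwise to `Φ`. -/
def NormalApproximation {Ω : Type*} [MeasurableSpace Ω] (θhat : ℕ → Ω → ℝ) (θ : ℝ)
    (P : Measure Ω) : Prop :=
  ∀ x : ℝ, Tendsto (fun n => P.real {ω | standardized (θhat n) θ P ω ≤ x}) atTop
    (𝓝 (stdNormalCDF x))

/-- The sample average `(1/n) ∑ h(xᵢ)`; for `h = id` it is the sample mean. -/
def sampleAverage (h : ℝ → ℝ) (n : ℕ) (x : Fin n → ℝ) : ℝ := (∑ i, h (x i)) / n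

end

/-! The estimate lies in the interval exactly when `-z ≤ Z ≤ z`, so the coverage is `P(Z ≤ z) - P(Z
< -z)` (`coverage_eq_sub`), while symmetry of `Φ` gives `Φ(z) - Φ(-z) = 1 - α`. Each term is within
`δ` of its normal value, or converges to it; the strict inequality costs nothing because `Φ` is
continuous. For sample averages, `Z` is a normalized sum of i.i.d. standardized variables, and the
central limit theorem applies. As `Φ` is strictly increasing, a tabulated z-score only requires
locating `Φ` at the two ends of its rounding interval. Integrated Taylor bounds for `exp (-t² / 2)`
and decimal bounds for `π` do this in rational arithmetic. -/

lemma stdNormalCDF_eq_real (x : ℝ) : stdNormalCDF x = (gaussianReal 0 1).real (Set.Iic x) :=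
  cdf_eq_real _ x

lemma stdNormalCDF_sub (a b : ℝ) :
    stdNormalCDF b - stdNormalCDF a = ∫ t in a..b, gaussianPDFReal 0 1 t := by
  have key (x : ℝ) : stdNormalCDF x = ∫ t in Set.Iic x, gaussianPDFReal 0 1 t := by
    rw [stdNormalCDF_eq_real, measureReal_def, gaussianReal_apply_eq_integral 0 one_ne_zero,
      ENNReal.toReal_ofReal (integral_nonneg fun t => gaussianPDFReal_nonneg 0 1 t)]
  rw [key, key]
  exact intervalIntegral.integral_Iic_sub_Iic (integrable_gaussianPDFReal 0 1).integrableOn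
    (integrable_gaussianPDFReal 0 1).integrableOn

/-- The law is invariant under reflection and has no atoms, so `Ici x` and `Ioi x` have equal mass.
-/
lemma stdNormalCDF_neg (x : ℝ) : stdNormalCDF (-x) = 1 - stdNormalCDF x := by
  have := nullSingletonClass_gaussianReal (μ := 0) (v := 1) one_ne_zero
  have hmap : (gaussianReal 0 1).map (fun y ↦ -y) = gaussianReal 0 1 := by
    rw [gaussianReal_map_neg, neg_zero]
  have h1 : (gaussianReal 0 1).real (Set.Iic (-x)) = (gaussianReal 0 1).real (Set.Ioi x) := by
    conv_lhs => rw [← hmap]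
    rw [map_measureReal_apply measurable_neg measurableSet_Iic,
      show (fun y : ℝ => -y) ⁻¹' Set.Iic (-x) = Set.Ici x by ext y; simp]
    exact (measureReal_congr Ioi_ae_eq_Ici).symm
  rw [stdNormalCDF_eq_real, stdNormalCDF_eq_real, h1, ← Set.compl_Iic,
    probReal_compl_eq_one_sub measurableSet_Iic]

lemma stdNormalCDF_zero : stdNormalCDF 0 = 1 / 2 := by
  have h := stdNormalCDF_neg 0
  rw [neg_zero] at h
  linarith

lemma stdNormalCDF_eq_integral (x : ℝ) :
    stdNormalCDF x = 1 / 2 + ∫ t in (0 : ℝ)..x, gaussianPDFReal 0 1 t := by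
  rw [← stdNormalCDF_sub, stdNormalCDF_zero]
  ring

lemma continuous_stdNormalCDF : Continuous stdNormalCDF := by
  rw [funext stdNormalCDF_eq_integral]
  exact continuous_const.add (intervalIntegral.continuous_primitive
    (fun a b => (integrable_gaussianPDFReal 0 1).intervalIntegrable) 0)

lemma strictMono_stdNormalCDF : StrictMono stdNormalCDF := by
  intro a b hab
  rw [← sub_pos, stdNormalCDF_sub]
  exact intervalIntegral.intervalIntegral_pos_of_pos
    (integrable_gaussianPDFReal 0 1).intervalIntegrable
    (fun t => gaussianPDFReal_pos 0 1 t one_ne_zero) hab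

lemma stdNormalCDF_zScore {p : ℝ} (hp : p ∈ Set.Ioo (0 : ℝ) 1) :
    stdNormalCDF (zScore p) = p := by
  obtain ⟨a, ha⟩ := ((tendsto_cdf_atBot (gaussianReal 0 1)).eventually_lt_const hp.1).exists
  obtain ⟨b, hb⟩ := ((tendsto_cdf_atTop (gaussianReal 0 1)).eventually_const_lt hp.2).exists
  obtain ⟨x, hx⟩ := mem_range_of_exists_le_of_exists_ge continuous_stdNormalCDF
    ⟨a, ha.le⟩ ⟨b, hb.le⟩
  have hset : {y : ℝ | p ≤ stdNormalCDF y} = Set.Ici x := by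
    ext y
    simp only [Set.mem_ofPred_eq, Set.mem_Ici, ← hx]
    exact strictMono_stdNormalCDF.le_iff_le
  rw [zScore, hset, csInf_Ici, hx]

lemma stdNormalCDF_eq_iff {p : ℝ} (hp : p ∈ Set.Ioo (0 : ℝ) 1) (x : ℝ) :
    stdNormalCDF x = p ↔ x = zScore p := by
  conv_lhs => rw [← stdNormalCDF_zScore hp]
  exact strictMono_stdNormalCDF.injective.eq_iff

lemma zScore_mem_Ioo {p a b : ℝ} (hp : p ∈ Set.Ioo (0 : ℝ) 1) (ha : stdNormalCDF a < p)
    (hb : p < stdNormalCDF b) : zScore p ∈ Set.Ioo a b := by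
  rw [← stdNormalCDF_zScore hp] at ha hb
  exact ⟨strictMono_stdNormalCDF.lt_iff_lt.1 ha, strictMono_stdNormalCDF.lt_iff_lt.1 hb⟩

/-! ### Numerical bounds for `Φ` -/

/-- The Taylor polynomials of `exp (-u)` are alternately upper and lower bounds on `u ≥ 0`. -/
lemma neg_one_pow_mul_exp_neg_sub_taylor_nonneg (N : ℕ) {u : ℝ} (hu : 0 ≤ u) :
    0 ≤ (-1) ^ N * (Real.exp (-u) - ∑ k ∈ Finset.range N, (-u) ^ k / k.factorial) := by
  induction N generalizing u with
  | zero => simpa using (Real.exp_pos _).le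
  | succ N ih =>
    -- The signed remainder `g` vanishes at 0 and its derivative is the previous signed remainder,
    -- nonnegative by induction.
    let g : ℝ → ℝ := fun u =>
      (-1) ^ (N + 1) * (Real.exp (-u) - ∑ k ∈ Finset.range (N + 1), (-u) ^ k / k.factorial)
    have hg (t : ℝ) : HasDerivAt g
        ((-1) ^ N * (Real.exp (-t) - ∑ k ∈ Finset.range N, (-t) ^ k / k.factorial)) t := by
      have hs : HasDerivAt (fun t : ℝ => ∑ k ∈ Finset.range (N + 1), (-t) ^ k / k.factorial)
          (∑ k ∈ Finset.range (N + 1), (k * (-t) ^ (k - 1) * -1) / k.factorial) t :=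
        HasDerivAt.fun_sum fun k _ => ((hasDerivAt_neg t).fun_pow k).div_const _
      have h := ((hasDerivAt_neg t).exp.sub hs).const_mul ((-1) ^ (N + 1))
      convert! h using 1
      rw [Finset.sum_range_succ', pow_succ]
      have : ∑ k ∈ Finset.range N,
          (((k + 1 : ℕ) : ℝ) * (-t) ^ (k + 1 - 1) * -1) / (k + 1).factorial
          = -∑ k ∈ Finset.range N, (-t) ^ k / k.factorial := by
        rw [← Finset.sum_neg_distrib]
        refine Finset.sum_congr rfl fun k _ => ?_
        have : (k.factorial : ℝ) ≠ 0 := by positivity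
        rw [Nat.factorial_succ]
        push_cast
        field_simp
      rw [this]
      simp
      ring
    have hmono : MonotoneOn g (Set.Ici 0) := by
      refine monotoneOn_of_deriv_nonneg (convex_Ici 0)
        (fun t _ => (hg t).continuousAt.continuousWithinAt)
        (fun t _ => (hg t).differentiableAt.differentiableWithinAt) fun t ht => ?_
      rw [(hg t).deriv]
      rw [interior_Ici] at ht
      exact ih (le_of_lt ht)
    have h0 : g 0 = 0 := by simp [g, Finset.sum_range_succ']
    have := hmono Set.self_mem_Ici (Set.mem_Ici.2 hu) hu
    rwa [h0] at this

/-- Taylor polynomials of `x ↦ ∫ t in 0..x, exp (-t² / 2)`. -/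
noncomputable def gaussTaylor (N : ℕ) (x : ℝ) : ℝ :=
  ∑ k ∈ Finset.range N, (-1) ^ k * x ^ (2 * k + 1) / (2 ^ k * k.factorial * (2 * k + 1))

lemma integral_taylor_exp_neg_sq (N : ℕ) (x : ℝ) :
    ∫ t in (0 : ℝ)..x, ∑ k ∈ Finset.range N, (-(t ^ 2 / 2)) ^ k / k.factorial
      = gaussTaylor N x := by
  rw [intervalIntegral.integral_finsetSum fun k _ =>
    Continuous.intervalIntegrable (by fun_prop) _ _]
  refine Finset.sum_congr rfl fun k _ => ?_
  have (t : ℝ) : (-(t ^ 2 / 2)) ^ k / k.factorial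
      = ((-1) ^ k / (2 ^ k * k.factorial)) * t ^ (2 * k) := by
    rw [neg_pow, div_pow, ← pow_mul]
    field_simp
  simp_rw [this]
  rw [intervalIntegral.integral_const_mul, integral_pow]
  simp
  field_simp

lemma neg_one_pow_mul_integral_exp_sub_nonneg (N : ℕ) {x : ℝ} (hx : 0 ≤ x) :
    0 ≤ (-1) ^ N * ((∫ t in (0 : ℝ)..x, Real.exp (-(t ^ 2 / 2))) - gaussTaylor N x) := by
  rw [← integral_taylor_exp_neg_sq, ← intervalIntegral.integral_sub
    (Continuous.intervalIntegrable (by fun_prop) _ _)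
    (Continuous.intervalIntegrable (by fun_prop) _ _), ← intervalIntegral.integral_const_mul]
  exact intervalIntegral.integral_nonneg hx fun t _ =>
    neg_one_pow_mul_exp_neg_sub_taylor_nonneg N (by positivity)

lemma stdNormalCDF_eq_integral_exp (x : ℝ) :
    stdNormalCDF x = 1 / 2 + (∫ t in (0 : ℝ)..x, Real.exp (-(t ^ 2 / 2))) / √(2 * Real.pi) := by
  rw [stdNormalCDF_eq_integral, div_eq_inv_mul _ √(2 * Real.pi),
    ← intervalIntegral.integral_const_mul]
  simp [gaussianPDFReal, neg_div]

/-- An odd number of terms overestimates the integral. Squaring removes `√(2π)`, so for rational `x`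
and `q` the hypothesis is a rational inequality. -/
lemma stdNormalCDF_lt_of_gaussTaylor {N : ℕ} (hN : Odd N) {x q : ℝ} (hx : 0 ≤ x)
    (hq : 1 / 2 < q) (h : gaussTaylor N x ^ 2 < (q - 1 / 2) ^ 2 * (2 * 3.14159265)) :
    stdNormalCDF x < q := by
  have h1 := neg_one_pow_mul_integral_exp_sub_nonneg N hx
  rw [hN.neg_one_pow] at h1
  have h2 : gaussTaylor N x < (q - 1 / 2) * √(2 * Real.pi) := by
    refine lt_of_pow_lt_pow_left₀ 2 (mul_nonneg (by linarith) (Real.sqrt_nonneg _)) ?_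
    rw [mul_pow, Real.sq_sqrt (by positivity)]
    refine h.trans_le ?_
    gcongr
    linarith [Real.pi_gt_d20]
  have h3 : (∫ t in (0 : ℝ)..x, Real.exp (-(t ^ 2 / 2))) / √(2 * Real.pi) < q - 1 / 2 := by
    rw [div_lt_iff₀ (by positivity)]
    linarith
  rw [stdNormalCDF_eq_integral_exp]
  linarith

lemma lt_stdNormalCDF_of_gaussTaylor {N : ℕ} (hN : Even N) {x q : ℝ} (hx : 0 ≤ x)
    (h0 : 0 ≤ gaussTaylor N x)
    (h : (q - 1 / 2) ^ 2 * (2 * 3.14159266) < gaussTaylor N x ^ 2) :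
    q < stdNormalCDF x := by
  have h1 := neg_one_pow_mul_integral_exp_sub_nonneg N hx
  rw [hN.neg_one_pow] at h1
  have h2 : (q - 1 / 2) * √(2 * Real.pi) < gaussTaylor N x := by
    refine lt_of_pow_lt_pow_left₀ 2 h0 ?_
    rw [mul_pow, Real.sq_sqrt (by positivity)]
    refine lt_of_le_of_lt ?_ h
    gcongr
    linarith [Real.pi_lt_d20]
  have h3 : q - 1 / 2 < (∫ t in (0 : ℝ)..x, Real.exp (-(t ^ 2 / 2))) / √(2 * Real.pi) := by
    rw [lt_div_iff₀ (by positivity)]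
    linarith
  rw [stdNormalCDF_eq_integral_exp]
  linarith

lemma abs_zScore_975_sub_lt : |zScore 0.975 - 1.96| < 0.005 := by
  -- The brackets are `1.96 ± 0.005`; the parity of `N` selects an upper or a lower bound.
  have h := zScore_mem_Ioo (p := 0.975) (a := 1.955) (b := 1.965) (by norm_num)
    (stdNormalCDF_lt_of_gaussTaylor (N := 11) (by decide) (by norm_num) (by norm_num)
      (by norm_num [gaussTaylor, Finset.sum_range_succ, Nat.factorial]))
    (lt_stdNormalCDF_of_gaussTaylor (N := 12) (by decide) (by norm_num)
      (by norm_num [gaussTaylor, Finset.sum_range_succ, Nat.factorial])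
      (by norm_num [gaussTaylor, Finset.sum_range_succ, Nat.factorial]))
  rw [abs_lt]
  constructor <;> linarith [h.1, h.2]

lemma abs_zScore_995_sub_lt : |zScore 0.995 - 2.576| < 0.0005 := by
  have h := zScore_mem_Ioo (p := 0.995) (a := 2.5755) (b := 2.5765) (by norm_num)
    (stdNormalCDF_lt_of_gaussTaylor (N := 19) (by decide) (by norm_num) (by norm_num)
      (by norm_num [gaussTaylor, Finset.sum_range_succ, Nat.factorial]))
    (lt_stdNormalCDF_of_gaussTaylor (N := 20) (by decide) (by norm_num)
      (by norm_num [gaussTaylor, Finset.sum_range_succ, Nat.factorial])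
      (by norm_num [gaussTaylor, Finset.sum_range_succ, Nat.factorial]))
  rw [abs_lt]
  constructor <;> linarith [h.1, h.2]

/-! ### Coverage and the normal approximation -/

section Coverage

variable {Ω : Type*} [MeasurableSpace Ω] {P : Measure Ω}

lemma coverage_eq_sub [IsFiniteMeasure P] {θhat : Ω → ℝ} {θ : ℝ}
    (hU : IsUnbiasedEstimate θhat θ P) {α : ℝ} (hz : 0 ≤ zScore (1 - α / 2)) :
    coverage θhat θ α P = P.real {ω | standardized θhat θ P ω ≤ zScore (1 - α / 2)}
      - P.real {ω | standardized θhat θ P ω < -zScore (1 - α / 2)} := by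
  have hs : 0 < √(Var[θhat; P]) := Real.sqrt_pos.2 hU.variance_pos
  have hm : AEMeasurable (standardized θhat θ P) P :=
    (hU.memLp.aemeasurable.sub_const θ).div_const _
  rw [eq_sub_iff_add_eq, add_comm, coverage]
  -- Split `{Z ≤ z}` along `{Z < -z}`, which it contains because `z ≥ 0`.
  rw [← measureReal_inter_add_sdiff₀ (s := {ω | standardized θhat θ P ω ≤ zScore (1 - α / 2)})
    (nullMeasurableSet_lt hm aemeasurable_const)]
  congr 2
  · ext ω
    simp only [Set.mem_ofPred_eq, Set.mem_inter_iff]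
    exact ⟨fun h => ⟨by linarith, h⟩, fun h => h.2⟩
  · ext ω
    simp only [standardized, Set.mem_ofPred_eq, Set.mem_Icc, Set.mem_sdiff, not_lt,
      div_le_iff₀ hs, le_div_iff₀ hs]
    constructor <;> rintro ⟨h1, h2⟩ <;> constructor <;> linarith

lemma stdNormalCDF_zScore_sub {α : ℝ} (hα : α ∈ Set.Ioo (0 : ℝ) 1) :
    stdNormalCDF (zScore (1 - α / 2)) - stdNormalCDF (-zScore (1 - α / 2)) = 1 - α := by
  rw [stdNormalCDF_neg, stdNormalCDF_zScore ⟨by linarith [hα.2], by linarith [hα.1]⟩]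
  ring

lemma zScore_nonneg {α : ℝ} (hα : α ∈ Set.Ioo (0 : ℝ) 1) : 0 ≤ zScore (1 - α / 2) := by
  rw [← strictMono_stdNormalCDF.le_iff_le,
    stdNormalCDF_zScore ⟨by linarith [hα.2], by linarith [hα.1]⟩, stdNormalCDF_zero]
  linarith [hα.2]

lemma abs_measureReal_lt_sub_stdNormalCDF_le [IsFiniteMeasure P] {Z : Ω → ℝ} {δ : ℝ}
    (h : ∀ x : ℝ, |P.real {ω | Z ω ≤ x} - stdNormalCDF x| ≤ δ) (x : ℝ) :
    |P.real {ω | Z ω < x} - stdNormalCDF x| ≤ δ := by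
  -- Let `y` increase to `x`: only `Φ` has to be continuous, the law of `Z` may have atoms.
  have hlow : stdNormalCDF x ≤ P.real {ω | Z ω < x} + δ := by
    refine le_of_tendsto (continuous_stdNormalCDF.continuousWithinAt (s := Set.Iio x)) ?_
    filter_upwards [self_mem_nhdsWithin] with y hy
    have h1 : P.real {ω | Z ω ≤ y} ≤ P.real {ω | Z ω < x} :=
      measureReal_mono fun ω hω => Set.mem_ofPred.2 ((Set.mem_ofPred.1 hω).trans_lt hy)
    linarith [(abs_le.1 (h y)).1]
  have hup : P.real {ω | Z ω < x} ≤ P.real {ω | Z ω ≤ x} :=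
    measureReal_mono fun ω hω => Set.mem_ofPred.2 (Set.mem_ofPred.1 hω).le
  rw [abs_le]
  constructor <;> linarith [(abs_le.1 (h x)).2]

lemma tendsto_measureReal_lt_stdNormalCDF [IsFiniteMeasure P] {Z : ℕ → Ω → ℝ}
    (h : ∀ x : ℝ, Tendsto (fun n => P.real {ω | Z n ω ≤ x}) atTop (𝓝 (stdNormalCDF x))) (x : ℝ) :
    Tendsto (fun n => P.real {ω | Z n ω < x}) atTop (𝓝 (stdNormalCDF x)) := by
  refine tendsto_order.2 ⟨fun a ha => ?_, fun a ha => ?_⟩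
  · obtain ⟨y, hay, hy⟩ := (((continuous_stdNormalCDF.continuousWithinAt (s := Set.Iio x)
      ).eventually_const_lt ha).and self_mem_nhdsWithin).exists
    filter_upwards [(h y).eventually_const_lt hay] with n hn
    exact hn.trans_le (measureReal_mono fun ω hω =>
      Set.mem_ofPred.2 ((Set.mem_ofPred.1 hω).trans_lt hy))
  · filter_upwards [(h x).eventually_lt_const ha] with n hn
    exact lt_of_le_of_lt (measureReal_mono fun ω hω =>
      Set.mem_ofPred.2 (Set.mem_ofPred.1 hω).le) hn

lemma abs_coverage_sub_le [IsFiniteMeasure P] {θhat : Ω → ℝ} {θ α δ : ℝ}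
    (hα : α ∈ Set.Ioo (0 : ℝ) 1) (hU : IsUnbiasedEstimate θhat θ P)
    (h : ∀ x : ℝ, |P.real {ω | standardized θhat θ P ω ≤ x} - stdNormalCDF x| ≤ δ) :
    |coverage θhat θ α P - (1 - α)| ≤ 2 * δ := by
  rw [coverage_eq_sub hU (zScore_nonneg hα), ← stdNormalCDF_zScore_sub hα, sub_sub_sub_comm]
  refine (abs_sub _ _).trans ?_
  linarith [h (zScore (1 - α / 2)),
    abs_measureReal_lt_sub_stdNormalCDF_le h (-zScore (1 - α / 2))]

lemma tendsto_coverage [IsFiniteMeasure P] {θhat : ℕ → Ω → ℝ} {θ α : ℝ}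
    (hα : α ∈ Set.Ioo (0 : ℝ) 1) (hU : ∀ᶠ n in atTop, IsUnbiasedEstimate (θhat n) θ P)
    (h : NormalApproximation θhat θ P) :
    Tendsto (fun n => coverage (θhat n) θ α P) atTop (𝓝 (1 - α)) := by
  rw [← stdNormalCDF_zScore_sub hα]
  refine ((h _).sub (tendsto_measureReal_lt_stdNormalCDF h _)).congr' ?_
  filter_upwards [hU] with n hn
  exact (coverage_eq_sub hn (zScore_nonneg hα)).symm

/-- Portmanteau: the frontier `{x}` of `Iic x` is null for the Gaussian. -/
lemma tendsto_measureReal_le_of_tendstoInDistribution [IsProbabilityMeasure P] {Z : ℕ → Ω → ℝ}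
    (h : TendstoInDistribution Z atTop id (fun _ => P) (gaussianReal 0 1)) (x : ℝ) :
    Tendsto (fun n => P.real {ω | Z n ω ≤ x}) atTop (𝓝 (stdNormalCDF x)) := by
  have := nullSingletonClass_gaussianReal (μ := 0) (v := 1) one_ne_zero
  have key := ProbabilityMeasure.tendsto_measure_of_null_frontier_of_tendsto' h.tendsto
    (E := Set.Iic x) (by simp)
  have key' := (ENNReal.tendsto_toReal (by simp)).comp key
  rw [stdNormalCDF_eq_real]
  convert! key' using 2 with n
  · simp only [Function.comp_apply, ProbabilityMeasure.coe_mk]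
    rw [Measure.map_apply_of_aemeasurable (h.forall_aemeasurable n) measurableSet_Iic]
    rfl
  · simp [measureReal_def]

end Coverage

/-! ### Sample averages and the central limit theorem -/

section SampleAverage

variable {Ω : Type*} [MeasurableSpace Ω] {P : Measure Ω}
  {ν : Measure ℝ} {X : ℕ → Ω → ℝ} {h : ℝ → ℝ}

lemma onSample_sampleAverage {Ω : Type*} {X : ℕ → Ω → ℝ} {h : ℝ → ℝ} (n : ℕ) :
    onSample (sampleAverage h n) X = fun ω => (∑ i ∈ Finset.range n, h (X i ω)) / n := by
  ext ω
  simp only [onSample, sampleAverage]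
  rw [Fin.sum_univ_eq_sum_range (fun i => h (X i ω)) n]

lemma IsRandomSample.memLp_comp (hX : IsRandomSample X ν P) (hL : MemLp h 2 ν) (i : ℕ) :
    MemLp (fun ω => h (X i ω)) 2 P := by
  have hi := hX.hasLaw i
  rw [← hi.map_eq] at hL
  exact (memLp_map_measure_iff hL.1 hi.aemeasurable).1 hL

lemma IsRandomSample.integral_comp (hX : IsRandomSample X ν P) (hm : Measurable h) (i : ℕ) :
    ∫ ω, h (X i ω) ∂P = ∫ x, h x ∂ν :=
  (hX.hasLaw i).integral_comp hm.aestronglyMeasurable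

lemma IsRandomSample.variance_comp (hX : IsRandomSample X ν P) (hm : Measurable h) (i : ℕ) :
    Var[fun ω => h (X i ω); P] = Var[h; ν] := by
  rw [← (hX.hasLaw i).map_eq, variance_map hm.aemeasurable (hX.hasLaw i).aemeasurable]
  rfl

lemma IsRandomSample.variance_sampleAverage [IsProbabilityMeasure P]
    (hX : IsRandomSample X ν P) (hm : Measurable h)
    (hL : MemLp h 2 ν) (n : ℕ) :
    Var[onSample (sampleAverage h n) X; P] = Var[h; ν] / n := by
  have hsum : Var[∑ i ∈ Finset.range n, fun ω => h (X i ω); P] = n * Var[h; ν] := by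
    rw [IndepFun.variance_sum (fun i _ => hX.memLp_comp hL i)
      fun i _ j _ hij => (hX.indep.indepFun hij).comp hm hm]
    simp [hX.variance_comp hm]
  have heq : onSample (sampleAverage h n) X
      = fun ω => (n : ℝ)⁻¹ * (∑ i ∈ Finset.range n, fun ω => h (X i ω)) ω := by
    rw [onSample_sampleAverage]
    ext ω
    simp [div_eq_inv_mul]
  rw [heq, variance_const_mul, hsum]
  -- For `n = 0` both sides vanish, since division by zero gives zero.
  rcases eq_or_ne n 0 with rfl | hn
  · simp
  · field_simp

lemma IsRandomSample.isUnbiasedEstimate_sampleAverage [IsProbabilityMeasure P]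
    (hX : IsRandomSample X ν P)
    (hm : Measurable h) (hL : MemLp h 2 ν) (hv : 0 < Var[h; ν]) {n : ℕ} (hn : 0 < n) :
    IsUnbiasedEstimate (onSample (sampleAverage h n) X) (∫ x, h x ∂ν) P where
  memLp := by
    rw [onSample_sampleAverage]
    simp_rw [div_eq_inv_mul]
    exact (memLp_finsetSum _ fun i _ => hX.memLp_comp hL i).const_mul _
  mean_eq := by
    rw [onSample_sampleAverage, integral_div, integral_finsetSum _ fun i _ =>
      (hX.memLp_comp hL i).integrable one_le_two]
    simp only [hX.integral_comp hm, Finset.sum_const, Finset.card_range, nsmul_eq_mul]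
    field_simp
  variance_pos := by
    rw [hX.variance_sampleAverage hm hL]
    positivity

lemma IsRandomSample.normalApproximation_sampleAverage [IsProbabilityMeasure P]
    (hX : IsRandomSample X ν P)
    (hm : Measurable h) (hL : MemLp h 2 ν) (hv : 0 < Var[h; ν]) :
    NormalApproximation (fun n => onSample (sampleAverage h n) X) (∫ x, h x ∂ν) P := by
  have hs : 0 < √(Var[h; ν]) := Real.sqrt_pos.2 hv
  -- Under `ν`, `g` has mean 0 and variance 1, as the central limit theorem below demands.
  let g : ℝ → ℝ := fun x => (h x - ∫ x, h x ∂ν) / √(Var[h; ν])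
  have hg : Measurable g := (hm.sub_const _).div_const _
  have hst (n : ℕ) : standardized (onSample (sampleAverage h n) X) (∫ x, h x ∂ν) P
      = fun ω => (√n)⁻¹ * ∑ k ∈ Finset.range n, g (X k ω) := by
    ext ω
    rw [standardized, hX.variance_sampleAverage hm hL, onSample_sampleAverage]
    rcases Nat.eq_zero_or_pos n with rfl | hn
    · simp
    have hn' : (0 : ℝ) < n := by exact_mod_cast hn
    have hn'' : 0 < √(n : ℝ) := Real.sqrt_pos.2 hn'
    simp only [g]
    rw [← Finset.sum_div, Finset.sum_sub_distrib, Real.sqrt_div hv.le]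
    simp only [Finset.sum_const, Finset.card_range, nsmul_eq_mul]
    field_simp
    rw [Real.sq_sqrt hn'.le]
    ring
  intro x
  simp_rw [hst]
  refine tendsto_measureReal_le_of_tendstoInDistribution ?_ x
  refine tendstoInDistribution_inv_sqrt_mul_sum (X := fun k ω => g (X k ω)) HasLaw.id ?_ ?_
    (hX.indep.comp (fun _ => g) fun _ => hg) fun i => ?_
  · rw [integral_div, integral_sub ((hX.memLp_comp hL 0).integrable one_le_two)
      (integrable_const _), hX.integral_comp hm]
    simp
  · have h2 := variance_eq_integral (hX.memLp_comp hL 0).aemeasurable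
    rw [hX.variance_comp hm, hX.integral_comp hm] at h2
    simp only [Pi.pow_apply, g, div_pow]
    rw [integral_div, ← h2, Real.sq_sqrt hv.le, div_self hv.ne']
  · exact (IdentDistrib.mk (hX.hasLaw i).aemeasurable (hX.hasLaw 0).aemeasurable
      ((hX.hasLaw i).map_eq.trans (hX.hasLaw 0).map_eq.symm)).comp hg

end SampleAverage

theorem mainTheorem12 {Ω : Type*} [MeasurableSpace Ω] (P : Measure Ω) [IsProbabilityMeasure P]
    {Θ : Set ℝ} (model : Θ → Measure ℝ) (θ : Θ) (X : ℕ → Ω → ℝ)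
    (hX : IsRandomSample X (model θ) P) (α : ℝ) (hα : α ∈ Set.Ioo (0 : ℝ) 1) :
    -- the z-score is the unique solution of `Φ(x) = 1 - α/2`, with the tabulated values
    (∀ x : ℝ, stdNormalCDF x = 1 - α / 2 ↔ x = zScore (1 - α / 2)) ∧
    (α = 0.05 → |zScore (1 - α / 2) - 1.96| < 0.005) ∧
    (α = 0.01 → |zScore (1 - α / 2) - 2.576| < 0.0005) ∧
    -- fixed sample size: the coverage is `1 - α` up to twice the error of the normal approximation
    (∀ (n : ℕ) (T : (Fin n → ℝ) → ℝ), Measurable T →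
      IsUnbiasedEstimate (onSample T X) θ P →
      ∀ δ : ℝ,
        (∀ x : ℝ, |P.real {ω | standardized (onSample T X) θ P ω ≤ x} - stdNormalCDF x| ≤ δ) →
        |coverage (onSample T X) θ α P - (1 - α)| ≤ 2 * δ) ∧
    -- growing sample size: any unbiased estimate to which the normal approximation applies
    (∀ T : (n : ℕ) → (Fin n → ℝ) → ℝ, (∀ n, Measurable (T n)) →
      (∀ᶠ n in atTop, IsUnbiasedEstimate (onSample (T n) X) θ P) →
      NormalApproximation (fun n => onSample (T n) X) θ P →
      Tendsto (fun n => coverage (onSample (T n) X) θ α P) atTop (𝓝 (1 - α))) ∧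
    -- unbiased sample averages: the central limit theorem supplies the normal approximation
    (∀ h : ℝ → ℝ, Measurable h → MemLp h 2 (model θ) → ∫ x, h x ∂(model θ) = θ →
      0 < Var[h; model θ] →
      (∀ n : ℕ, 0 < n → IsUnbiasedEstimate (onSample (sampleAverage h n) X) θ P) ∧
      NormalApproximation (fun n => onSample (sampleAverage h n) X) θ P ∧
      Tendsto (fun n => coverage (onSample (sampleAverage h n) X) θ α P) atTop
        (𝓝 (1 - α))) := by
  have hp : 1 - α / 2 ∈ Set.Ioo (0 : ℝ) 1 := ⟨by linarith [hα.2], by linarith [hα.1]⟩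
  refine ⟨stdNormalCDF_eq_iff hp, ?_, ?_, fun n T _ hU δ hδ => abs_coverage_sub_le hα hU hδ,
    fun T _ hU hN => tendsto_coverage hα hU hN, fun h hm hL hmean hv => ?_⟩
  · rintro rfl
    convert! abs_zScore_975_sub_lt using 4
    norm_num
  · rintro rfl
    convert! abs_zScore_995_sub_lt using 4
    norm_num
  · have hU : ∀ n : ℕ, 0 < n → IsUnbiasedEstimate (onSample (sampleAverage h n) X) θ P :=
      fun n hn => hmean ▸ hX.isUnbiasedEstimate_sampleAverage hm hL hv hn
    have hN : NormalApproximation (fun n => onSample (sampleAverage h n) X) θ P :=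
      hmean ▸ hX.normalApproximation_sampleAverage hm hL hv
    exact ⟨hU, hN, tendsto_coverage hα ((eventually_gt_atTop 0).mono hU) hN⟩
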